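/- Let $\sigma\in\mathbb R$, $\beta>0$, $I_\sigma=(-\infty,\sigma)$ and $\varphi_1(t)=(2\pi)^{-1/2}e^{-t^2/2}$. Let $H^1(I_\sigma,\varphi_1)$ be the space of all $u\in W^{1,1}_{\rm loc}(I_\sigma)$ with $\int_{I_\sigma}(u^2+(u')^2)\varphi_1\,dt<\infty$; for such $u$, let $u(\sigma)$ denote its trace, i.e. the value at $\sigma$ of its representative that is continuous on $(-\infty,\sigma]$. Consider the Robin eigenvalue problem $$-w''+tw'=\lambda w\ \text{ in } I_\sigma,\qquad w'(\sigma)+\beta w(\sigma)=0,$$ where $\lambda\in\mathbb R$ is an eigenvalue with eigenfunction $u\in H^1(I_\sigma,\varphi_1)$, $u\neq0$, if $$\int_{I_\sigma}u'\psi'\varphi_1\,dt+\beta\,u(\sigma)\psi(\sigma)\varphi_1(\sigma)=\lambda\int_{I_\sigma}u\,\psi\,\varphi_1\,dt\qquad\text{for all }\psi\in H^1(I_\sigma,\varphi_1).$$ Let $\lambda$ be the smallest eigenvalue and let $w$ be an eigenfunction for $\lambda$ that is positive a.e. in $I_\sigma$. Then $w$ has a representative, again denoted by $w$, which is $C^\infty$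 and positive on $(-\infty,\sigma]$ (with one-sided derivatives at $\sigma$) and satisfies $-w''+tw'=\lambda w$ in $I_\sigma$; and the function $$\beta(t)=-\frac{w'(t)}{w(t)},\qquad t\in(-\infty,\sigma],$$ is positive and strictly increasing on $(-\infty,\sigma)$, with $\beta(\sigma)=\beta$. Consequently $w$ is log-concave; indeed $\log w$ is strictly concave on $I_\sigma$. -/

import Mathlib

open Real Set Filter Topology MeasureTheory ProbabilityTheory
open scoped ContDiff

noncomputable section

namespace HermiteRobin

/-- The standard Gaussian density `φ₁(t) = (2π)^{-1/2} exp(-t²/2)`. -/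
abbrev phi (t : ℝ) : ℝ := gaussianPDFReal 0 1 t

/-- The standard Gaussian measure `φ₁(t) dt` on the half-line `I_σ = (-∞, σ)`. -/
abbrev gammaHalf (σ : ℝ) : Measure ℝ := (gaussianReal 0 1).restrict (Iio σ)

/-- `g` is the weak (distributional) derivative of `u` on `I_σ = (-∞, σ)`, both being locally
integrable there; that is, `u ∈ W^{1,1}_loc(I_σ)` and `u' = g`. -/
structure HasWeakDeriv (σ : ℝ) (u g : ℝ → ℝ) : Prop where
  locallyIntegrable : LocallyIntegrableOn u (Iio σ) volume
  locallyIntegrable_deriv : LocallyIntegrableOn g (Iio σ) volume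
  integral_eq : ∀ η : ℝ → ℝ, ContDiff ℝ ∞ η → HasCompactSupport η → tsupport η ⊆ Iio σ →
    ∫ t in Iio σ, u t * deriv η t = - ∫ t in Iio σ, g t * η t

/-- `u` belongs to the Gaussian Sobolev space `H¹(I_σ, φ₁)`, with weak derivative `g`. -/
structure IsH1 (σ : ℝ) (u g : ℝ → ℝ) : Prop where
  hasWeakDeriv : HasWeakDeriv σ u g
  memLp : MemLp u 2 (gammaHalf σ)
  memLp_deriv : MemLp g 2 (gammaHalf σ)

/-- The trace of `u` at the boundary point `σ` of `I_σ` is `a`: the value at `σ` of the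
representative of `u` that is continuous on `(-∞, σ]`. (Every `u ∈ H¹(I_σ, φ₁)` has exactly one
such representative.) -/
def HasTrace (σ : ℝ) (u : ℝ → ℝ) (a : ℝ) : Prop :=
  ∃ V : ℝ → ℝ, ContinuousOn V (Iic σ) ∧ u =ᵐ[volume.restrict (Iio σ)] V ∧ V σ = a

/-- `u` is an eigenfunction, with eigenvalue `lam`, of the Robin problem
`-w'' + t w' = lam w` in `I_σ`, `w'(σ) + β w(σ) = 0`, in the weak sense: `u ∈ H¹(I_σ, φ₁)`,
`u ≠ 0`, and
`∫ u' ψ' φ₁ dt + β u(σ) ψ(σ) φ₁(σ) = lam ∫ u ψ φ₁ dt` for all `ψ ∈ H¹(I_σ, φ₁)`. -/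
def IsEigenfunction (σ β lam : ℝ) (u : ℝ → ℝ) : Prop :=
  ¬ (u =ᵐ[volume.restrict (Iio σ)] 0) ∧
  ∃ (g : ℝ → ℝ) (a : ℝ), IsH1 σ u g ∧ HasTrace σ u a ∧
    ∀ (ψ ψ' : ℝ → ℝ) (b : ℝ), IsH1 σ ψ ψ' → HasTrace σ ψ b →
      ∫ t, g t * ψ' t ∂(gammaHalf σ) + β * (a * b * phi σ)
        = lam * ∫ t, u t * ψ t ∂(gammaHalf σ)

/-- The set of eigenvalues of the Robin problem on `I_σ` with parameter `β`. -/
def eigenvalues (σ β : ℝ) : Set ℝ := {lam | ∃ u : ℝ → ℝ, IsEigenfunction σ β lam u}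

/-- `w` is a first eigenfunction: an eigenfunction whose eigenvalue `lam` is the smallest one. -/
def IsFirstEigenfunction (σ β lam : ℝ) (w : ℝ → ℝ) : Prop :=
  IsLeast (eigenvalues σ β) lam ∧ IsEigenfunction σ β lam w

/-- The function `t ↦ -w'(t) / w(t)` on `(-∞, σ]`; the derivative is two-sided at `t < σ` and
one-sided (from the left) at `t = σ`. -/
def robinQuotient (σ : ℝ) (w : ℝ → ℝ) (t : ℝ) : ℝ := - derivWithin w (Iic σ) t / w t

end HermiteRobin

end

/-!
The proof has two halves.

*Regularity.* Testing the weak equation with a primitive `ψ = ∫_{-∞}^t ζ` of a test function `ζ`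
and integrating by parts shows that the flux `w' φ₁` equals
`-β w(σ) φ₁(σ) + lam ∫_t^σ w φ₁` almost everywhere (`flux_ae_eq`). The equation and the Robin
condition thus come out together, since such `ψ` do not vanish at `σ`. With the du Bois-Reymond
lemma, `w` then agrees on `(-∞, σ]` with a classical solution
(`exists_classical_solution`), which is smooth by bootstrapping. The test function `1` gives
`lam ∫ w φ₁ = β w(σ) φ₁(σ)`, so `lam ≥ 0`. As the flux is then nonincreasing, a zero of `w` would
force `w` to vanish to its left (`eq_zero_of_double_zero`), so `w > 0` up to `σ`, and the same
identity gives `lam > 0`.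

*Monotonicity.* The flux `w' φ₁` is strictly decreasing, which forces `w' < 0`, as `w` could not
stay positive near `-∞` otherwise (`deriv_neg_of_pos`). The quotient `b = -w'/w` solves the Riccati
equation `b' = b² + t b + lam`, and `φ₁ w² b'` has derivative `-φ₁ w w' > 0`. If `b'` were
nonpositive somewhere, then `φ₁ w² b' ≤ -c < 0` near `-∞`; integrability of `φ₁ w²` makes `b`
grow faster than any linear function there, against the bound `b < -t` that `b' < 0` imposes
(`riccati_pos`). Hence `b' > 0`, and `(log w)' = -b` is strictly decreasing.
-/

namespace HermiteRobin

/-! ### The Gaussian density and the measure on the half-line -/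

lemma hasDerivAt_phi (t : ℝ) : HasDerivAt phi (-t * phi t) t := by
  have h : phi = fun t => (√(2 * π))⁻¹ * rexp (-t ^ 2 / 2) := by
    ext x; simp [phi, gaussianPDFReal]
  rw [h]
  have h1 : HasDerivAt (fun t : ℝ => -t ^ 2 / 2) (-t) t := by
    refine (((hasDerivAt_pow 2 t).neg).div_const 2).congr_deriv ?_
    norm_num
    ring
  refine ((h1.exp).const_mul ((√(2 * π))⁻¹)).congr_deriv ?_
  ring

lemma phi_pos (t : ℝ) : 0 < phi t := gaussianPDFReal_pos _ _ _ one_ne_zero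

lemma continuous_phi : Continuous phi :=
  continuous_iff_continuousAt.2 fun t => (hasDerivAt_phi t).continuousAt

lemma integral_gammaHalf (σ : ℝ) (f : ℝ → ℝ) :
    ∫ t, f t ∂(gammaHalf σ) = ∫ t in Iio σ, phi t * f t := by
  rw [← integral_indicator measurableSet_Iio, integral_gaussianReal_eq_integral_smul one_ne_zero,
    ← integral_indicator measurableSet_Iio]
  congr 1
  ext t
  by_cases h : t ∈ Iio σ <;> simp [h]

lemma integrable_gammaHalf_iff (σ : ℝ) (f : ℝ → ℝ) :
    Integrable f (gammaHalf σ) ↔ IntegrableOn (fun t => phi t * f t) (Iio σ) := by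
  rw [gammaHalf, gaussianReal_of_var_ne_zero _ one_ne_zero,
    restrict_withDensity measurableSet_Iio,
    integrable_withDensity_iff_integrable_smul' (measurable_gaussianPDF _ _)
      (Eventually.of_forall fun _ => gaussianPDF_lt_top)]
  simp [IntegrableOn, toReal_gaussianPDF]

lemma ae_gammaHalf_iff (σ : ℝ) (p : ℝ → Prop) :
    (∀ᵐ t ∂(gammaHalf σ), p t) ↔ ∀ᵐ t ∂(volume.restrict (Iio σ)), p t := by
  have h1 : gaussianReal 0 1 ≪ volume := gaussianReal_absolutelyContinuous 0 one_ne_zero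
  have h2 : volume ≪ gaussianReal 0 1 := gaussianReal_absolutelyContinuous' 0 one_ne_zero
  exact ⟨fun h => (h2.restrict _).ae_le h, fun h => (h1.restrict _).ae_le h⟩

/-! ### Regularity of weak solutions -/

section Regularity

variable {σ : ℝ}

lemma exists_tsupport_subset_Icc {η : ℝ → ℝ} (hc : HasCompactSupport η)
    (hs : tsupport η ⊆ Iio σ) : ∃ s r, s ≤ r ∧ r < σ ∧ tsupport η ⊆ Icc s r := by
  have hK : IsCompact (insert (σ - 1) (tsupport η)) := hc.isCompact.insert _
  obtain ⟨s, -, hs'⟩ := hK.exists_isLeast (insert_nonempty _ _)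
  obtain ⟨r, hr, hr'⟩ := hK.exists_isGreatest (insert_nonempty _ _)
  refine ⟨s, r, hs' hr, ?_, fun t ht => ⟨hs' (mem_insert_of_mem _ ht), hr' (mem_insert_of_mem _ ht)⟩⟩
  rcases hr with rfl | hr
  · linarith
  · exact hs hr

lemma setIntegral_eq_of_tsupport_subset {η f : ℝ → ℝ} (hs : tsupport η ⊆ Iio σ) :
    ∫ t in Iio σ, η t * f t = ∫ t, η t * f t :=
  setIntegral_eq_integral_of_forall_compl_eq_zero fun t ht => by
    rw [image_eq_zero_of_notMem_tsupport fun h => ht (hs h), zero_mul]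

lemma integrable_mul_of_locallyIntegrableOn {η f : ℝ → ℝ} (hη : Continuous η)
    (hc : HasCompactSupport η) (hs : tsupport η ⊆ Iio σ)
    (hf : LocallyIntegrableOn f (Iio σ)) : Integrable (fun t => η t * f t) := by
  refine (integrableOn_iff_integrable_of_support_subset (s := tsupport η) ?_).1
    ((hf.integrableOn_compact_subset hs hc.isCompact).continuousOn_mul hη.continuousOn
      hc.isCompact)
  intro t ht
  exact subset_tsupport _ (left_ne_zero_of_mul ht)

/-- The primitive of a test function that vanishes near `-∞`. -/
lemma exists_primitive {ζ : ℝ → ℝ} (hζ : Continuous ζ) (hc : HasCompactSupport ζ)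
    (hs : tsupport ζ ⊆ Iio σ) :
    ∃ (ψ : ℝ → ℝ) (s r : ℝ), r < σ ∧ (∀ t, HasDerivAt ψ (ζ t) t) ∧ (∀ t ≤ s, ψ t = 0) ∧
      (∀ t ≥ r, ψ t = ∫ x, ζ x) ∧ s ≤ r ∧ ∃ C, ∀ t, |ψ t| ≤ C := by
  obtain ⟨s, r, hsr, hr, hK⟩ := exists_tsupport_subset_Icc hc hs
  have hint : Integrable ζ := hζ.integrable_of_hasCompactSupport hc
  have hz : ∀ t, t ∉ Icc s r → ζ t = 0 := fun t ht =>
    image_eq_zero_of_notMem_tsupport fun h => ht (hK h)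
  refine ⟨fun t => ∫ x in (s - 1)..t, ζ x, s - 1, r, hr, fun t => ?_, fun t ht => ?_, fun t ht => ?_,
    by linarith, ∫ x, ‖ζ x‖, fun t => ?_⟩
  · exact intervalIntegral.integral_hasDerivAt_right (hζ.intervalIntegrable _ _)
      hζ.stronglyMeasurable.stronglyMeasurableAtFilter hζ.continuousAt
  · refine intervalIntegral.integral_zero_ae (Eventually.of_forall fun x hx => hz x fun h => ?_)
    rw [uIoc_of_ge ht] at hx
    linarith [hx.2, h.1]
  · refine intervalIntegral.integral_eq_integral_of_support_subset fun x hx => ?_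
    have : x ∈ Icc s r := by
      by_contra h
      exact hx (hz x h)
    exact ⟨by linarith [this.1], this.2.trans ht⟩
  · exact (intervalIntegral.norm_integral_le_integral_norm_uIoc).trans
      (setIntegral_le_integral hint.norm (Eventually.of_forall fun x => norm_nonneg _))

/-- Integration by parts against a test function. -/
lemma setIntegral_mul_deriv_eq {U q η : ℝ → ℝ} (hU : ∀ t, HasDerivAt U (q t) t)
    (hq : Continuous q) (hη : ContDiff ℝ ∞ η) (hc : HasCompactSupport η)
    (hs : tsupport η ⊆ Iio σ) :
    ∫ t in Iio σ, U t * deriv η t = - ∫ t in Iio σ, q t * η t := by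
  have hUc : Continuous U := continuous_iff_continuousAt.2 fun t => (hU t).continuousAt
  have hηc := hη.continuous
  have hη' : Continuous (deriv η) := hη.continuous_deriv (by simp)
  simp_rw [fun t => mul_comm (U t), fun t => mul_comm (q t)]
  rw [setIntegral_eq_of_tsupport_subset hs,
    setIntegral_eq_of_tsupport_subset ((show tsupport (deriv η) ⊆ _ from tsupport_deriv_subset).trans hs)]
  simp_rw [fun t => mul_comm (η t), fun t => mul_comm (deriv η t)]
  refine integral_mul_deriv_eq_deriv_mul_of_integrable (fun t _ => hU t)
    (fun t _ => (hη.differentiable (by simp) t).hasDerivAt) ?_ ?_ ?_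
  · exact (hUc.mul hη').integrable_of_hasCompactSupport hc.deriv.mul_left
  · exact (hq.mul hηc).integrable_of_hasCompactSupport hc.mul_left
  · exact (hUc.mul hηc).integrable_of_hasCompactSupport hc.mul_left

/-- Bounded `C¹` functions with bounded derivative belong to the Gaussian Sobolev space. -/
lemma isH1_of_bounded {ψ ζ : ℝ → ℝ} (hψ : ∀ t, HasDerivAt ψ (ζ t) t) (hζ : Continuous ζ)
    {C D : ℝ} (hC : ∀ t, |ψ t| ≤ C) (hD : ∀ t, |ζ t| ≤ D) : IsH1 σ ψ ζ := by
  have hψc : Continuous ψ := continuous_iff_continuousAt.2 fun t => (hψ t).continuousAt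
  refine ⟨⟨hψc.locallyIntegrable.locallyIntegrableOn _, hζ.locallyIntegrable.locallyIntegrableOn _,
    fun η h1 h2 h3 => setIntegral_mul_deriv_eq hψ hζ h1 h2 h3⟩, ?_, ?_⟩
  · exact MemLp.of_bound hψc.aestronglyMeasurable C (Eventually.of_forall hC)
  · exact MemLp.of_bound hζ.aestronglyMeasurable D (Eventually.of_forall hD)

/-- **Du Bois-Reymond lemma** on a half-line: a function with vanishing weak derivative is
constant. -/
lemma ae_eq_const_of_integral_mul_deriv_eq_zero {u : ℝ → ℝ}
    (hu : LocallyIntegrableOn u (Iio σ))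
    (h : ∀ η : ℝ → ℝ, ContDiff ℝ ∞ η → HasCompactSupport η → tsupport η ⊆ Iio σ →
      ∫ t, deriv η t * u t = 0) :
    ∃ c, ∀ᵐ t ∂(volume.restrict (Iio σ)), u t = c := by
  let b : ContDiffBump (σ - 2) := ⟨1 / 2, 1, by norm_num, by norm_num⟩
  set θ : ℝ → ℝ := b.normed volume with hθ
  have hθ1 : ContDiff ℝ ∞ θ := b.contDiff_normed
  have hθ2 : HasCompactSupport θ := b.hasCompactSupport_normed
  have hθ3 : tsupport θ ⊆ Iio σ := by
    rw [hθ, b.tsupport_normed_eq, Real.closedBall_eq_Icc]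
    intro t ht
    have := ht.2
    simp only [mem_Iio]
    change t ≤ σ - 2 + 1 at this
    linarith
  have hθ4 : ∫ t, θ t = 1 := b.integral_normed
  have hθu := integrable_mul_of_locallyIntegrableOn hθ1.continuous hθ2 hθ3 hu
  refine ⟨∫ t, θ t * u t, ?_⟩
  set c := ∫ t, θ t * u t with hc
  rw [ae_restrict_iff' measurableSet_Iio]
  have key := isOpen_Iio.ae_eq_zero_of_integral_contDiff_smul_eq_zero (U := Iio σ) (μ := volume)
    (f := fun t => u t - c) (hu.sub (continuous_const.locallyIntegrable.locallyIntegrableOn _)) ?_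
  · filter_upwards [key] with t ht h using sub_eq_zero.1 (ht h)
  intro ζ hζ1 hζ2 hζ3
  have hζu := integrable_mul_of_locallyIntegrableOn hζ1.continuous hζ2 hζ3 hu
  have hζi := hζ1.continuous.integrable_of_hasCompactSupport (μ := volume) hζ2
  have hθi := hθ1.continuous.integrable_of_hasCompactSupport (μ := volume) hθ2
  -- A test function of integral zero is the derivative of a test function.
  set k := ∫ t, ζ t with hk
  set ξ : ℝ → ℝ := fun t => ζ t - k * θ t with hξ
  have hξ1 : ContDiff ℝ ∞ ξ := hζ1.sub (contDiff_const.mul hθ1)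
  have hξ2 : HasCompactSupport ξ := hζ2.sub hθ2.mul_left
  have hξ3 : tsupport ξ ⊆ Iio σ :=
    (tsupport_sub _ _).trans (union_subset hζ3 ((tsupport_mul_subset_right).trans hθ3))
  have hξ4 : ∫ t, ξ t = 0 := by
    rw [hξ, integral_sub hζi (hθi.const_mul k), integral_const_mul, hθ4, hk]
    ring
  obtain ⟨ψ, s, r, hr, hψ, hψs, hψr, hsr, -⟩ := exists_primitive hξ1.continuous hξ2 hξ3
  rw [hξ4] at hψr
  have hdψ : deriv ψ = ξ := funext fun t => (hψ t).deriv
  have hz : ∀ t, t ∉ Icc s r → ψ t = 0 := fun t ht => by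
    by_cases h1 : t ≤ s
    · exact hψs t h1
    · exact hψr t (by by_contra h2; exact ht ⟨by linarith, by linarith⟩)
  have h0 := h ψ (contDiff_infty_iff_deriv.2 ⟨fun t => (hψ t).differentiableAt, hdψ ▸ hξ1⟩)
    (HasCompactSupport.intro isCompact_Icc hz)
    ((closure_minimal (fun t ht => by by_contra h; exact ht (hz t h)) isClosed_Icc).trans
      (Icc_subset_Iio_iff hsr |>.2 hr))
  rw [hdψ] at h0
  have e1 : ∫ t, ξ t * u t = (∫ t, ζ t * u t) - k * c := by
    rw [hc, ← integral_const_mul, ← integral_sub hζu (hθu.const_mul k)]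
    congr 1; ext t; simp only [hξ]; ring
  have e2 : ∫ t, ζ t • (u t - c) = (∫ t, ζ t * u t) - k * c := by
    rw [hk, ← integral_mul_const, ← integral_sub hζu (hζi.mul_const c)]
    congr 1; ext t; simp only [smul_eq_mul]; ring
  rw [e2, ← e1, h0]

/-- The weak equation, tested against primitives of test functions, identifies the flux `u' φ₁`
with a primitive of `-lam u φ₁`, and its value at `σ` with that given by the Robin condition. -/
lemma flux_ae_eq {β lam a : ℝ} {u g V : ℝ → ℝ} (hu : IsH1 σ u g) (hV : Continuous V)
    (huV : u =ᵐ[volume.restrict (Iio σ)] V)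
    (hweak : ∀ (ψ ψ' : ℝ → ℝ) (b : ℝ), IsH1 σ ψ ψ' → HasTrace σ ψ b →
      ∫ t, g t * ψ' t ∂(gammaHalf σ) + β * (a * b * phi σ)
        = lam * ∫ t, u t * ψ t ∂(gammaHalf σ)) :
    ∀ᵐ t ∂(volume.restrict (Iio σ)),
      phi t * g t = -(β * a * phi σ) - lam * ∫ x in σ..t, V x * phi x := by
  set p : ℝ → ℝ := fun t => -(β * a * phi σ) - lam * ∫ x in σ..t, V x * phi x with hp
  have hVφ : Continuous fun x => V x * phi x := hV.mul continuous_phi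
  have hpd : ∀ t, HasDerivAt p (-(lam * (V t * phi t))) t := fun t =>
    (((intervalIntegral.integral_hasDerivAt_right (hVφ.intervalIntegrable σ t)
      hVφ.stronglyMeasurable.stronglyMeasurableAtFilter hVφ.continuousAt).const_mul
        lam).const_sub _)
  have hpc : Continuous p := continuous_iff_continuousAt.2 fun t => (hpd t).continuousAt
  have hpσ : p σ = -(β * a * phi σ) := by simp [hp]
  have hgi : IntegrableOn (fun t => phi t * g t) (Iio σ) :=
    (integrable_gammaHalf_iff σ g).1 (hu.memLp_deriv.integrable (by norm_num))
  rw [ae_restrict_iff' measurableSet_Iio]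
  have key := isOpen_Iio.ae_eq_zero_of_integral_contDiff_smul_eq_zero (U := Iio σ) (μ := volume)
    (f := fun t => phi t * g t - p t)
    (hgi.locallyIntegrableOn.sub (hpc.locallyIntegrable.locallyIntegrableOn _)) ?_
  · filter_upwards [key] with t ht h using sub_eq_zero.1 (ht h)
  intro ζ hζ1 hζ2 hζ3
  obtain ⟨ψ, s, r, hr, hψ, hψs, hψr, hsr, C, hC⟩ := exists_primitive hζ1.continuous hζ2 hζ3
  have hψc : Continuous ψ := continuous_iff_continuousAt.2 fun t => (hψ t).continuousAt
  obtain ⟨D, hD⟩ := hζ2.exists_bound_of_continuous hζ1.continuous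
  have hw := hweak ψ ζ (ψ σ) (isH1_of_bounded hψ hζ1.continuous hC hD)
    ⟨ψ, hψc.continuousOn, Filter.EventuallyEq.rfl, rfl⟩
  rw [integral_gammaHalf, integral_gammaHalf] at hw
  have hsσ : s ≤ σ := by linarith
  have hζs : ∀ t ≤ s - 1, ζ t = 0 := fun t ht => by
    have : ψ =ᶠ[𝓝 t] fun _ => 0 := by
      filter_upwards [Iio_mem_nhds (show t < s by linarith)] with x hx using hψs x (le_of_lt hx)
    rw [← (hψ t).deriv, this.deriv_eq, deriv_const]
  -- Integration by parts on a compact interval, outside which the integrands vanish.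
  have hparts := intervalIntegral.integral_mul_deriv_eq_deriv_mul (a := s - 1) (b := σ)
    (fun t _ => hpd t) (fun t _ => hψ t)
    ((continuous_const.mul hVφ).neg.intervalIntegrable _ _) (hζ1.continuous.intervalIntegrable _ _)
  have e1 : ∫ t in (s - 1)..σ, p t * ζ t = ∫ t, p t * ζ t := by
    refine intervalIntegral.integral_eq_integral_of_support_subset fun t ht => ⟨?_, ?_⟩
    · by_contra! h
      exact right_ne_zero_of_mul ht (hζs t h)
    · exact le_of_lt (hζ3 (subset_tsupport _ (right_ne_zero_of_mul ht)))
  have e2 : ∫ t in Iio σ, phi t * (u t * ψ t) = ∫ t in (s - 1)..σ, V t * phi t * ψ t := by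
    rw [intervalIntegral.integral_of_le (by linarith)]
    have : ∫ t in Iio σ, phi t * (u t * ψ t) = ∫ t in Iio σ, V t * phi t * ψ t := by
      refine integral_congr_ae ?_
      filter_upwards [huV] with t ht
      rw [ht]; ring
    rw [this, ← integral_Iic_eq_integral_Iio]
    refine setIntegral_eq_of_subset_of_forall_sdiff_eq_zero measurableSet_Iic
      (fun t ht => ht.2) fun t ht => ?_
    have hts : t ≤ s - 1 := by
      by_contra! h
      exact ht.2 ⟨h, ht.1⟩
    rw [hψs t (by linarith), mul_zero]
  have e3 : ∫ t in Iio σ, phi t * (g t * ζ t) = ∫ t, ζ t * (phi t * g t) := by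
    rw [← setIntegral_eq_of_tsupport_subset hζ3]
    congr 1; ext t; ring
  have e4 : ∫ t in (s - 1)..σ, -(lam * (V t * phi t)) * ψ t
      = -(lam * ∫ t in (s - 1)..σ, V t * phi t * ψ t) := by
    rw [← intervalIntegral.integral_const_mul, ← intervalIntegral.integral_neg]
    congr 1; ext t; ring
  rw [e2, e3] at hw
  rw [e1, e4, hpσ, hψs (s - 1) (by linarith)] at hparts
  have e5 : ∫ t, ζ t • (phi t * g t - p t) = (∫ t, ζ t * (phi t * g t)) - ∫ t, p t * ζ t := by
    rw [← integral_sub (integrable_mul_of_locallyIntegrableOn hζ1.continuous hζ2 hζ3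
      hgi.locallyIntegrableOn) (show Integrable fun t => p t * ζ t from
      (hpc.mul hζ1.continuous).integrable_of_hasCompactSupport hζ2.mul_left)]
    congr 1; ext t; simp only [smul_eq_mul]; ring
  rw [e5, hparts]
  linear_combination hw

/-- **Regularity of weak solutions**: on `(-∞, σ]` an eigenfunction agrees with a `C¹` function on
the line which solves the equation classically, has the right trace, and satisfies the Robin
condition. -/
lemma exists_classical_solution {β lam a : ℝ} {u g : ℝ → ℝ} (hu : IsH1 σ u g)
    (ha : HasTrace σ u a)
    (hweak : ∀ (ψ ψ' : ℝ → ℝ) (b : ℝ), IsH1 σ ψ ψ' → HasTrace σ ψ b →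
      ∫ t, g t * ψ' t ∂(gammaHalf σ) + β * (a * b * phi σ)
        = lam * ∫ t, u t * ψ t ∂(gammaHalf σ)) :
    ∃ W q : ℝ → ℝ, u =ᵐ[volume.restrict (Iio σ)] W ∧ W σ = a ∧ q σ = -(β * a) ∧
      (∀ t, HasDerivAt W (q t) t) ∧ ∀ t ≤ σ, HasDerivAt q (t * q t - lam * W t) t := by
  obtain ⟨V₀, hV₀, huV₀, hV₀σ⟩ := ha
  -- The continuous representative, extended by a constant to the right of `σ`.
  set V : ℝ → ℝ := fun t => V₀ (min t σ) with hVdef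
  have hVc : Continuous V := hV₀.comp_continuous (continuous_id.min continuous_const)
    fun t => mem_Iic.2 (min_le_right _ _)
  have hVV₀ : ∀ t ≤ σ, V t = V₀ t := fun t ht => by simp [hVdef, ht]
  have huV : u =ᵐ[volume.restrict (Iio σ)] V := by
    filter_upwards [huV₀, ae_restrict_mem measurableSet_Iio] with t ht hmem
    rw [ht, hVV₀ t (le_of_lt hmem)]
  have hflux := flux_ae_eq hu hVc huV hweak
  set p : ℝ → ℝ := fun t => -(β * a * phi σ) - lam * ∫ x in σ..t, V x * phi x with hp
  have hVφ : Continuous fun x => V x * phi x := hVc.mul continuous_phi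
  have hpd : ∀ t, HasDerivAt p (-(lam * (V t * phi t))) t := fun t =>
    (((intervalIntegral.integral_hasDerivAt_right (hVφ.intervalIntegrable σ t)
      hVφ.stronglyMeasurable.stronglyMeasurableAtFilter hVφ.continuousAt).const_mul
        lam).const_sub _)
  set q : ℝ → ℝ := fun t => p t / phi t with hqdef
  have hqd : ∀ t, HasDerivAt q (t * q t - lam * V t) t := fun t => by
    have hφ := (phi_pos t).ne'
    refine ((hpd t).div (hasDerivAt_phi t) hφ).congr_deriv ?_
    simp only [hqdef]
    field_simp
    ring
  have hqc : Continuous q := continuous_iff_continuousAt.2 fun t => (hqd t).continuousAt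
  have hgq : g =ᵐ[volume.restrict (Iio σ)] q := by
    filter_upwards [hflux] with t ht
    rw [hqdef, eq_div_iff (phi_pos t).ne', mul_comm]
    exact ht
  have hUd : ∀ t, HasDerivAt (fun t => ∫ x in σ..t, q x) (q t) t := fun t =>
    intervalIntegral.integral_hasDerivAt_right (hqc.intervalIntegrable σ t)
      hqc.stronglyMeasurable.stronglyMeasurableAtFilter hqc.continuousAt
  set U : ℝ → ℝ := fun t => ∫ x in σ..t, q x with hUdef
  have hUc : Continuous U := continuous_iff_continuousAt.2 fun t => (hUd t).continuousAt
  have hUl : LocallyIntegrableOn U (Iio σ) := hUc.locallyIntegrable.locallyIntegrableOn _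
  -- The difference of `u` and the primitive `U` of its derivative has vanishing weak derivative.
  obtain ⟨c, hc⟩ := ae_eq_const_of_integral_mul_deriv_eq_zero (u := fun t => u t - U t)
    (hu.hasWeakDeriv.locallyIntegrable.sub hUl) fun η h1 h2 h3 => by
    have h3' : tsupport (deriv η) ⊆ Iio σ := tsupport_deriv_subset.trans h3
    have hη' : Continuous (deriv η) := h1.continuous_deriv (by simp)
    have i1 := hu.hasWeakDeriv.integral_eq η h1 h2 h3
    have i2 := setIntegral_mul_deriv_eq hUd hqc h1 h2 h3
    have i3 : ∫ t in Iio σ, g t * η t = ∫ t in Iio σ, q t * η t := by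
      refine integral_congr_ae ?_
      filter_upwards [hgq] with t ht
      rw [ht]
    simp_rw [fun t => mul_comm (u t)] at i1
    simp_rw [fun t => mul_comm (U t)] at i2
    rw [setIntegral_eq_of_tsupport_subset h3'] at i1 i2
    simp_rw [mul_sub]
    rw [integral_sub (integrable_mul_of_locallyIntegrableOn hη' h2.deriv h3'
      hu.hasWeakDeriv.locallyIntegrable)
      (integrable_mul_of_locallyIntegrableOn hη' h2.deriv h3' hUl), i1, i2, i3, sub_self]
  have hWV : EqOn V (fun t => U t + c) (Iic σ) := by
    have : V =ᵐ[volume.restrict (Iio σ)] fun t => U t + c := by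
      filter_upwards [huV, hc] with t h1 h2
      rw [← h1, ← h2]; ring
    have := Measure.eqOn_open_of_ae_eq this isOpen_Iio hVc.continuousOn
      (hUc.add continuous_const).continuousOn
    simpa using this.closure hVc (hUc.add continuous_const)
  refine ⟨fun t => U t + c, q, ?_, ?_, ?_, fun t => (hUd t).add_const c, fun t ht => ?_⟩
  · filter_upwards [hc] with t ht
    rw [← ht]; ring
  · rw [← hV₀σ, ← hVV₀ σ le_rfl, hWV (mem_Iic.2 le_rfl)]
  · have := (phi_pos σ).ne'
    simp only [hqdef, hp, intervalIntegral.integral_same]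
    field_simp
    ring
  · have := hWV (mem_Iic.2 ht)
    simp only at this ⊢
    rw [← this]
    exact hqd t

end Regularity

/-! ### Positive classical solutions and the Riccati equation -/

section Classical

variable {σ lam : ℝ} {W q : ℝ → ℝ}

/-- The equation in divergence form, for the flux `W' φ₁`; here and below `q` stands for `W'`. -/
lemma hasDerivAt_mul_phi (hq : ∀ t ≤ σ, HasDerivAt q (t * q t - lam * W t) t) {t : ℝ}
    (ht : t ≤ σ) : HasDerivAt (fun t => q t * phi t) (-(lam * W t * phi t)) t := by
  refine ((hq t ht).mul (hasDerivAt_phi t)).congr_deriv ?_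
  ring

lemma antitoneOn_mul_phi (hlam : 0 ≤ lam) (hW : ∀ t ≤ σ, 0 ≤ W t)
    (hq : ∀ t ≤ σ, HasDerivAt q (t * q t - lam * W t) t) :
    AntitoneOn (fun t => q t * phi t) (Iic σ) := by
  refine antitoneOn_of_hasDerivWithinAt_nonpos (convex_Iic σ)
    (fun t ht => (hasDerivAt_mul_phi hq ht).continuousAt.continuousWithinAt)
    (fun t ht => (hasDerivAt_mul_phi hq (mem_Iic.1 (interior_subset ht))).hasDerivWithinAt) fun t ht => ?_
  have := mul_nonneg (mul_nonneg hlam (hW t (mem_Iic.1 (interior_subset ht)))) (phi_pos t).le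
  linarith

lemma strictAntiOn_mul_phi (hlam : 0 < lam) (hW : ∀ t ≤ σ, 0 < W t)
    (hq : ∀ t ≤ σ, HasDerivAt q (t * q t - lam * W t) t) :
    StrictAntiOn (fun t => q t * phi t) (Iic σ) := by
  refine strictAntiOn_of_hasDerivWithinAt_neg (convex_Iic σ)
    (fun t ht => (hasDerivAt_mul_phi hq ht).continuousAt.continuousWithinAt)
    (fun t ht => (hasDerivAt_mul_phi hq (mem_Iic.1 (interior_subset ht))).hasDerivWithinAt) fun t ht => ?_
  have := mul_pos (mul_pos hlam (hW t (mem_Iic.1 (interior_subset ht)))) (phi_pos t)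
  linarith

/-- A nonnegative solution with a double zero vanishes to the left of it: the flux, being
nonincreasing, is nonnegative there, so that `W` is nondecreasing and at most its value `0`. -/
lemma eq_zero_of_double_zero (hlam : 0 ≤ lam) (hW0 : ∀ t ≤ σ, 0 ≤ W t)
    (hW : ∀ t, HasDerivAt W (q t) t)
    (hq : ∀ t ≤ σ, HasDerivAt q (t * q t - lam * W t) t) {s : ℝ} (hs : s ≤ σ)
    (h0 : W s = 0) (h1 : q s = 0) : ∀ t ≤ s, W t = 0 := by
  intro t ht
  have hmono : MonotoneOn W (Iic s) := by
    refine monotoneOn_of_hasDerivWithinAt_nonneg (convex_Iic s)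
      (fun t _ => (hW t).continuousAt.continuousWithinAt)
      (fun t _ => (hW t).hasDerivWithinAt) fun t ht => ?_
    have ht : t ≤ s := mem_Iic.1 (interior_subset ht)
    have := antitoneOn_mul_phi hlam hW0 hq (ht.trans hs : t ∈ Iic σ) hs ht
    simp only [h1, zero_mul] at this
    exact nonneg_of_mul_nonneg_left this (phi_pos t)
  have := hmono ht (le_refl s : s ∈ Iic s) ht
  exact le_antisymm (h0 ▸ this) (hW0 t (ht.trans hs))

/-- A positive solution is strictly decreasing: a nonnegative slope at one point would, since the
flux `W' φ₁` decreases, bound the slope below by a positive constant further to the left, and `W`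
would become negative. -/
lemma deriv_neg_of_pos (hlam : 0 < lam) (hW0 : ∀ t ≤ σ, 0 < W t)
    (hW : ∀ t, HasDerivAt W (q t) t)
    (hq : ∀ t ≤ σ, HasDerivAt q (t * q t - lam * W t) t) {s : ℝ} (hs : s ≤ σ) : q s < 0 := by
  by_contra! hqs
  have hanti := strictAntiOn_mul_phi hlam hW0 hq
  set c := q (s - 1) * phi (s - 1) with hc
  have hcpos : 0 < c := by
    have := hanti (show s - 1 ∈ Iic σ by simp; linarith) (show s ∈ Iic σ from hs) (by linarith)
    exact lt_of_le_of_lt (mul_nonneg hqs (phi_pos s).le) this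
  -- The density is at most `1`, so the slope is at least the flux.
  have hphi : ∀ t, phi t ≤ 1 := fun t => by
    simp only [phi, gaussianPDFReal]
    have h1 : (√(2 * π * ((1 : NNReal) : ℝ)))⁻¹ ≤ 1 := by
      apply inv_le_one_of_one_le₀
      rw [Real.one_le_sqrt]
      have := Real.pi_gt_three
      simp; linarith
    have h2 : rexp (-(t - 0) ^ 2 / (2 * ((1 : NNReal) : ℝ))) ≤ 1 := by
      rw [Real.exp_le_one_iff]
      have := sq_nonneg (t - 0)
      simp only [NNReal.coe_one]; linarith
    exact mul_le_one₀ h1 (exp_pos _).le h2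
  have hmono : MonotoneOn (fun t => W t - c * t) (Iic (s - 1)) := by
    have hd : ∀ t, HasDerivAt (fun t => W t - c * t) (q t - c) t := fun t => by
      exact ((hW t).sub ((hasDerivAt_id t).const_mul c)).congr_deriv (by simp)
    refine monotoneOn_of_hasDerivWithinAt_nonneg (convex_Iic _)
      (fun t _ => (hd t).continuousAt.continuousWithinAt)
      (fun t _ => (hd t).hasDerivWithinAt) fun t ht => ?_
    have ht : t ≤ s - 1 := mem_Iic.1 (interior_subset ht)
    have h := hanti.antitoneOn (show t ∈ Iic σ by simp; linarith)
      (show s - 1 ∈ Iic σ by simp; linarith) ht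
    have h : c ≤ q t * phi t := h
    have hqt : 0 < q t := pos_of_mul_pos_left (hcpos.trans_le h) (phi_pos t).le
    nlinarith [hphi t]
  have hWs := hW0 (s - 1) (by linarith)
  have hr : s - 1 - W (s - 1) / c ≤ s - 1 := by
    have := div_pos hWs hcpos
    linarith
  have h1 := hmono hr (le_refl (s - 1) : s - 1 ∈ Iic (s - 1)) hr
  have h2 := hW0 (s - 1 - W (s - 1) / c) (by linarith)
  have h3 : c * (W (s - 1) / c) = W (s - 1) := by field_simp
  simp only at h1
  nlinarith

/-- The Riccati equation of the logarithmic slope `-W'/W`. -/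
lemma hasDerivAt_neg_div (hW0 : ∀ t ≤ σ, 0 < W t) (hW : ∀ t, HasDerivAt W (q t) t)
    (hq : ∀ t ≤ σ, HasDerivAt q (t * q t - lam * W t) t) {t : ℝ} (ht : t ≤ σ) :
    HasDerivAt (fun t => -q t / W t) ((-q t / W t) ^ 2 + t * (-q t / W t) + lam) t := by
  have := hW0 t ht
  refine ((hq t ht).neg.div (hW t) this.ne').congr_deriv ?_
  simp only [Pi.neg_apply]
  field_simp
  ring

/-- The quantity `φ₁ W²` times the derivative of `-W'/W` is strictly increasing: it has derivative
`-φ₁ W W'`. -/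
lemma strictMonoOn_phi_mul_sq_mul (hlam : 0 < lam) (hW0 : ∀ t ≤ σ, 0 < W t)
    (hW : ∀ t, HasDerivAt W (q t) t)
    (hq : ∀ t ≤ σ, HasDerivAt q (t * q t - lam * W t) t) :
    StrictMonoOn (fun t => phi t * (q t ^ 2 - t * q t * W t + lam * W t ^ 2)) (Iic σ) := by
  have hd : ∀ t ≤ σ, HasDerivAt (fun t => phi t * (q t ^ 2 - t * q t * W t + lam * W t ^ 2))
      (-(phi t * W t * q t)) t := fun t ht => by
    have h := hq t ht
    have h' := (hasDerivAt_phi t).mul ((((h.pow 2).sub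
      (((hasDerivAt_id t).mul h).mul (hW t))).add (((hW t).pow 2).const_mul lam)))
    refine h'.congr_deriv ?_
    simp
    ring
  refine strictMonoOn_of_hasDerivWithinAt_pos (convex_Iic σ)
    (fun t ht => (hd t ht).continuousAt.continuousWithinAt)
    (fun t ht => (hd t (mem_Iic.1 (interior_subset ht))).hasDerivWithinAt) fun t ht => ?_
  have ht : t ≤ σ := mem_Iic.1 (interior_subset ht)
  have := mul_neg_of_pos_of_neg (mul_pos (phi_pos t) (hW0 t ht))
    (deriv_neg_of_pos hlam hW0 hW hq ht)
  linarith

/-- The derivative of `b = -W'/W` is positive if `W` is square integrable for `φ₁`. Otherwise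
`φ₁ W² b' ≤ -c < 0` near `-∞`, so that `b' ≤ -c / (φ₁ W²)`; as `φ₁ W²` is integrable this makes
`b` grow faster than linearly at `-∞`, whereas `b' = b² + t b + lam < 0` forces `b < -t`. -/
lemma riccati_pos (hlam : 0 < lam) (hW0 : ∀ t ≤ σ, 0 < W t)
    (hW : ∀ t, HasDerivAt W (q t) t)
    (hq : ∀ t ≤ σ, HasDerivAt q (t * q t - lam * W t) t)
    (hint : IntegrableOn (fun t => phi t * W t ^ 2) (Iio σ)) {r : ℝ} (hr : r ≤ σ) :
    0 < (-q r / W r) ^ 2 + r * (-q r / W r) + lam := by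
  set b : ℝ → ℝ := fun t => -q t / W t with hb
  set F : ℝ → ℝ := fun t => phi t * (q t ^ 2 - t * q t * W t + lam * W t ^ 2) with hF
  have hFb : ∀ t ≤ σ, F t = phi t * W t ^ 2 * (b t ^ 2 + t * b t + lam) := fun t ht => by
    have := hW0 t ht
    simp only [hF, hb]
    field_simp
    ring
  have hmono : StrictMonoOn F (Iic σ) := strictMonoOn_phi_mul_sq_mul hlam hW0 hW hq
  change 0 < b r ^ 2 + r * b r + lam
  by_contra! hneg
  have hFr : F r ≤ 0 := by
    rw [hFb r hr]
    exact mul_nonpos_of_nonneg_of_nonpos (mul_pos (phi_pos r) (pow_pos (hW0 r hr) 2)).le hneg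
  obtain ⟨c, hc⟩ : ∃ c, c = -F (r - 1) := ⟨_, rfl⟩
  have hcpos : 0 < c := by
    have := hmono (show r - 1 ∈ Iic σ by simp; linarith) (show r ∈ Iic σ from hr) (by linarith)
    linarith
  have hWc : Continuous W := continuous_iff_continuousAt.2 fun t => (hW t).continuousAt
  have hgc : Continuous fun t => phi t * W t ^ 2 := continuous_phi.mul (hWc.pow 2)
  -- Since `c / x ≥ 2 - x / c` for `x = φ₁ W²`, the bound `b' ≤ -c / x` integrates to a lower bound
  -- for `b` of the form `-2 t - const`, which beats `b t < -t`.
  have hanti : AntitoneOn (fun t => b t + 2 * t - (1 / c) * ∫ x in σ..t, phi x * W x ^ 2)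
      (Iic (r - 1)) := by
    have hd : ∀ t ≤ σ, HasDerivAt (fun t => b t + 2 * t - (1 / c) * ∫ x in σ..t, phi x * W x ^ 2)
        (b t ^ 2 + t * b t + lam + 2 - (1 / c) * (phi t * W t ^ 2)) t := fun t ht => by
      have h1 := hasDerivAt_neg_div hW0 hW hq ht
      have h2 := intervalIntegral.integral_hasDerivAt_right (hgc.intervalIntegrable σ t)
        hgc.stronglyMeasurable.stronglyMeasurableAtFilter hgc.continuousAt
      exact ((h1.add ((hasDerivAt_id t).const_mul 2)).sub (h2.const_mul (1 / c))).congr_deriv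
        (by simp [hb])
    have hle : ∀ t ≤ r - 1, t ≤ σ := fun t ht => by linarith
    refine antitoneOn_of_hasDerivWithinAt_nonpos (convex_Iic _)
      (fun t ht => (hd t (hle t ht)).continuousAt.continuousWithinAt)
      (fun t ht => (hd t (hle t (mem_Iic.1 (interior_subset ht)))).hasDerivWithinAt) fun t ht => ?_
    have ht : t ≤ r - 1 := mem_Iic.1 (interior_subset ht)
    have hFt : F t ≤ -c := by
      rw [hc, neg_neg]
      exact hmono.monotoneOn (hle t ht) (by simp; linarith) ht
    rw [hFb t (hle t ht)] at hFt
    have hx : 0 < phi t * W t ^ 2 := mul_pos (phi_pos t) (pow_pos (hW0 t (hle t ht)) 2)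
    generalize phi t * W t ^ 2 = x at hFt hx
    have h1 : b t ^ 2 + t * b t + lam ≤ -c / x := by
      rw [le_div_iff₀ hx]; linarith
    have h2 : -c / x + 2 - (1 / c) * x = -((x - c) ^ 2 / (c * x)) := by
      field_simp; ring
    have h3 : 0 ≤ (x - c) ^ 2 / (c * x) := by positivity
    linarith
  obtain ⟨K, hK⟩ : ∃ K, ∀ t ≤ σ, -K ≤ (1 / c) * ∫ x in σ..t, phi x * W x ^ 2 := by
    refine ⟨(1 / c) * ∫ x in Iio σ, phi x * W x ^ 2, fun t ht => ?_⟩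
    rw [intervalIntegral.integral_symm, mul_neg, neg_le_neg_iff]
    refine mul_le_mul_of_nonneg_left ?_ (by positivity)
    rw [intervalIntegral.integral_of_le ht, integral_Ioc_eq_integral_Ioo]
    exact setIntegral_mono_set hint
      (Eventually.of_forall fun x => mul_nonneg (phi_pos x).le (sq_nonneg _))
      (LE.le.eventuallyLE fun x hx => hx.2)
  obtain ⟨M, hM⟩ : ∃ M, M = b (r - 1) + 2 * (r - 1)
      - (1 / c) * ∫ x in σ..(r - 1), phi x * W x ^ 2 := ⟨_, rfl⟩
  have hlow : ∀ t ≤ r - 1, t ≤ M - K → False := fun t ht htM => by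
    have h1 := hanti ht (le_refl (r - 1) : r - 1 ∈ Iic (r - 1)) ht
    simp only [← hM] at h1
    have h2 := hK t (by linarith)
    have hbpos : 0 < b t :=
      div_pos (neg_pos.2 (deriv_neg_of_pos hlam hW0 hW hq (by linarith))) (hW0 t (by linarith))
    have hFt : F t < 0 :=
      (hmono (show t ∈ Iic σ by simp; linarith) (show r ∈ Iic σ from hr) (by linarith)).trans_le hFr
    rw [hFb t (by linarith)] at hFt
    have hbt : b t ^ 2 + t * b t + lam < 0 :=
      neg_of_mul_neg_right hFt (mul_pos (phi_pos t) (pow_pos (hW0 t (by linarith)) 2)).le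
    have h3 : b t < -t := by nlinarith
    linarith
  exact hlow (min (r - 1) (M - K)) (min_le_left _ _) (min_le_right _ _)

/-- Bootstrapping: classical solutions are smooth up to the boundary. -/
lemma contDiffOn_of_hasDerivAt (hW : ∀ t, HasDerivAt W (q t) t)
    (hq : ∀ t ≤ σ, HasDerivAt q (t * q t - lam * W t) t) : ContDiffOn ℝ ∞ W (Iic σ) := by
  have hu := uniqueDiffOn_Iic σ
  have hind : ∀ n : ℕ, ContDiffOn ℝ n W (Iic σ) ∧ ContDiffOn ℝ n q (Iic σ) := by
    intro n
    induction n with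
    | zero =>
      simp only [Nat.cast_zero, contDiffOn_zero]
      exact ⟨fun t _ => (hW t).continuousAt.continuousWithinAt,
        fun t ht => (hq t ht).continuousAt.continuousWithinAt⟩
    | succ n ih =>
      obtain ⟨h1, h2⟩ := ih
      simp only [Nat.cast_add, Nat.cast_one]
      rw [contDiffOn_succ_iff_derivWithin hu, contDiffOn_succ_iff_derivWithin hu]
      refine ⟨⟨fun t _ => (hW t).differentiableAt.differentiableWithinAt, by simp,
        h2.congr fun t ht => ?_⟩,
        ⟨fun t ht => (hq t ht).differentiableAt.differentiableWithinAt, by simp,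
        ((contDiffOn_id.mul h2).sub ((contDiffOn_const (c := lam)).mul h1)).congr fun t ht => ?_⟩⟩
      · exact (hW t).hasDerivWithinAt.derivWithin (hu t ht)
      · exact (hq t ht).hasDerivWithinAt.derivWithin (hu t ht)
  exact contDiffOn_infty.2 fun n => (hind n).1

/-- The Robin condition and the absence of double zeros make a solution that is positive almost
everywhere positive everywhere, including at `σ`. -/
lemma pos_of_ae_pos {β : ℝ} (hlam : 0 ≤ lam) (hW : ∀ t, HasDerivAt W (q t) t)
    (hq : ∀ t ≤ σ, HasDerivAt q (t * q t - lam * W t) t) (hσ : q σ = -(β * W σ))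
    (hW0 : ∀ t ≤ σ, 0 ≤ W t) (hpos : ∀ᵐ t ∂(volume.restrict (Iio σ)), 0 < W t) :
    ∀ t ≤ σ, 0 < W t := by
  intro t ht
  refine (hW0 t ht).lt_of_ne' fun h0 => ?_
  have hqt : q t = 0 := by
    rcases ht.lt_or_eq with hlt | rfl
    · have : IsLocalMin W t := by
        filter_upwards [Iio_mem_nhds hlt] with x hx
        rw [h0]
        exact hW0 x (le_of_lt hx)
      exact this.hasDerivAt_eq_zero (hW t)
    · rw [hσ, h0]; ring
  have hz := eq_zero_of_double_zero hlam hW0 hW hq ht h0 hqt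
  rw [ae_restrict_iff' measurableSet_Iio, ae_iff] at hpos
  have : volume (Iio t) ≤ 0 := hpos ▸ measure_mono fun x hx => by
    have hxt : x < t := hx
    simp [hz x hxt.le, hxt.trans_le ht]
  simp at this

end Classical

end HermiteRobin


/-! ### Log-concavity of the first eigenfunction -/

open HermiteRobin

theorem proposition3p2 (σ β lam : ℝ) (hβ : 0 < β) (w : ℝ → ℝ)
    (hw : HermiteRobin.IsFirstEigenfunction σ β lam w)
    (hpos : ∀ᵐ t ∂(volume.restrict (Iio σ)), 0 < w t) :
    ∃ W : ℝ → ℝ, w =ᵐ[volume.restrict (Iio σ)] W ∧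
      ContDiffOn ℝ ∞ W (Iic σ) ∧
      (∀ t ∈ Iic σ, 0 < W t) ∧
      (∀ t ∈ Iio σ, - deriv (deriv W) t + t * deriv W t = lam * W t) ∧
      (∀ t ∈ Iio σ, 0 < HermiteRobin.robinQuotient σ W t) ∧
      StrictMonoOn (HermiteRobin.robinQuotient σ W) (Iio σ) ∧
      HermiteRobin.robinQuotient σ W σ = β ∧
      StrictConcaveOn ℝ (Iio σ) (fun t => Real.log (W t)) := by
  obtain ⟨-, -, g, a, hu, ha, hweak⟩ := hw
  obtain ⟨W, q, hwW, hWσ, hqσ, hW, hq⟩ := exists_classical_solution hu ha hweak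
  subst hWσ
  have hWc : Continuous W := continuous_iff_continuousAt.2 fun t => (hW t).continuousAt
  have hWpos : ∀ᵐ t ∂(volume.restrict (Iio σ)), 0 < W t := by
    filter_upwards [hpos, hwW] with t h1 h2 using h2 ▸ h1
  have hW0 : ∀ t ≤ σ, 0 ≤ W t := by
    have h : EqOn (fun t => |W t|) W (Iio σ) := by
      refine Measure.eqOn_open_of_ae_eq (μ := volume) ?_ isOpen_Iio hWc.abs.continuousOn
        hWc.continuousOn
      filter_upwards [hWpos] with t ht using abs_of_pos ht
    have h := h.closure hWc.abs hWc
    rw [closure_Iio] at h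
    intro t ht
    rw [← h ht]
    exact abs_nonneg _
  -- The constant `1` as a test function relates `lam` to the boundary value.
  have htest := hweak (fun _ => 1) (fun _ => 0) 1
    (isH1_of_bounded (fun t => hasDerivAt_const t 1) continuous_const
      (C := 1) (D := 0) (by simp) (by simp))
    ⟨fun _ => 1, continuousOn_const, Filter.EventuallyEq.rfl, rfl⟩
  simp only [mul_zero, integral_zero, zero_add, mul_one] at htest
  have hint : 0 < ∫ t, w t ∂(gammaHalf σ) := by
    have h : ∀ᵐ t ∂(gammaHalf σ), 0 < w t := (ae_gammaHalf_iff σ _).2 hpos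
    refine (integral_nonneg_of_ae (h.mono fun t ht => ht.le)).lt_of_ne' fun h0 => ?_
    rw [integral_eq_zero_iff_of_nonneg_ae (h.mono fun t ht => ht.le)
      (hu.memLp.integrable (by norm_num))] at h0
    have hfalse : ∀ᵐ _ ∂(volume.restrict (Iio σ)), False := by
      rw [← ae_gammaHalf_iff]
      filter_upwards [h, h0] with t h1 h2
      exact h1.ne' h2
    rw [eventually_false_iff_eq_bot, ae_eq_bot, Measure.restrict_eq_zero] at hfalse
    simp at hfalse
  have hlam0 : 0 ≤ lam := by
    have : 0 ≤ lam * ∫ t, w t ∂(gammaHalf σ) := by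
      rw [← htest]
      exact mul_nonneg hβ.le (mul_nonneg (hW0 σ le_rfl) (phi_pos σ).le)
    exact nonneg_of_mul_nonneg_left this hint
  have hWp := pos_of_ae_pos hlam0 hW hq hqσ hW0 hWpos
  have hlam : 0 < lam := by
    have : 0 < lam * ∫ t, w t ∂(gammaHalf σ) := by
      rw [← htest]
      exact mul_pos hβ (mul_pos (hWp σ le_rfl) (phi_pos σ))
    exact pos_of_mul_pos_left this hint.le
  have hsq : IntegrableOn (fun t => phi t * W t ^ 2) (Iio σ) := by
    refine ((integrable_gammaHalf_iff σ _).1 hu.memLp.integrable_sq).congr ?_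
    filter_upwards [hwW] with t ht
    rw [ht]
  have hquot : EqOn (robinQuotient σ W) (fun t => -q t / W t) (Iic σ) := fun t ht => by
    rw [robinQuotient, (hW t).hasDerivWithinAt.derivWithin (uniqueDiffOn_Iic σ t ht)]
  have hdW : deriv W = q := funext fun t => (hW t).deriv
  have hmono : StrictMonoOn (fun t => -q t / W t) (Iic σ) := by
    have hd := fun t (ht : t ≤ σ) => hasDerivAt_neg_div hWp hW hq ht
    refine strictMonoOn_of_hasDerivWithinAt_pos (convex_Iic σ)
      (fun t ht => (hd t ht).continuousAt.continuousWithinAt)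
      (fun t ht => (hd t (mem_Iic.1 (interior_subset ht))).hasDerivWithinAt) fun t ht => ?_
    exact riccati_pos hlam hWp hW hq hsq (mem_Iic.1 (interior_subset ht))
  refine ⟨W, hwW, contDiffOn_of_hasDerivAt hW hq, hWp, fun t ht => ?_, fun t ht => ?_,
    (hmono.congr hquot.symm).mono Iio_subset_Iic_self, ?_, ?_⟩
  · rw [hdW, (hq t (le_of_lt ht)).deriv]
    ring
  · rw [hquot (mem_Iic.2 (le_of_lt ht))]
    exact div_pos (neg_pos.2 (deriv_neg_of_pos hlam hWp hW hq (le_of_lt ht))) (hWp t (le_of_lt ht))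
  · rw [hquot (mem_Iic.2 le_rfl)]
    simp only [hqσ]
    have := (hWp σ le_rfl).ne'
    field_simp
  · refine StrictAntiOn.strictConcaveOn_of_deriv (convex_Iio σ)
      (fun t ht => (hWc.continuousAt.log (hWp t (le_of_lt ht)).ne').continuousWithinAt) ?_
    rw [interior_Iio]
    intro x hx y hy hxy
    rw [((hW x).log (hWp x (le_of_lt hx)).ne').deriv, ((hW y).log (hWp y (le_of_lt hy)).ne').deriv]
    have := hmono (mem_Iic.2 (le_of_lt hx)) (mem_Iic.2 (le_of_lt hy)) hxy
    simp only [neg_div] at this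
    linarith
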